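/- Let $n\ge 1$. Let $\Lambda_W=\mathbb{Z}\{e_1,\dots,e_n\}/(e_1+\cdots+e_n=0)$ be the weight lattice of the root system $A_{n-1}$, viewed as the image of $\mathbb{Z}^n$ in the real vector space $V=\mathbb{R}^n/\mathbb{R}(1,\dots,1)$, and let $A=A_{n-1}=\{e_i-e_j : 1\le i<j\le n\}\subset\Lambda_W$ be its set of positive roots. For $B\subseteq A$ let $r(B)=\dim_{\mathbb{R}}\operatorname{span}B$, and let the multiplicity $m(B)$ be the index of $\mathbb{Z}B$ in $\operatorname{span}B\cap\Lambda_W$. Let $$M^W_{A}(x,y)=\sum_{B\subseteq A} m(B)\,(x-1)^{r(A)-r(B)}(y-1)^{|B|-r(B)}$$ be the arithmetic Tutte polynomial of $A_{n-1}$ in $\Lambda_W$, and let $$\chi^W_{A_{n-1}}(q)=(-1)^{r(A)}\,q^{\,\operatorname{rank}\Lambda_W-r(A)}\,M^W_{A}(1-q,0)$$ be its arithmetic characteristic polynomial (here $r(A)=\operatorname{rank}\Lambda_W=n-1$). Then, as polynomials in $q$, $$\chi^W_{A_{n-1}}(q)=\sum_{k=1}^{n}(-1)^{n-k}\,c_k\,q^{k-1},\qquad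 c_k=\sum_{\pi\in S_{n,k}}\gcd(\pi),$$ where $S_{n,k}$ is the set of permutations of $\{1,\dots,n\}$ with exactly $k$ cycles (fixed points counted as cycles of length $1$), and $\gcd(\pi)$ is the greatest common divisor of the lengths of the cycles of $\pi$. -/

import Mathlib

open scoped Polynomial

noncomputable section

namespace ArithTutte

section General

variable {V : Type*} [AddCommGroup V] [Module ℝ V] {ι : Type*}

/-- The rank `r(B) = dim span B` of the subconfiguration `B` of a vector configuration
`a : ι → V` (a finite indexed family of vectors of a real vector space). -/
def rank (a : ι → V) (B : Finset ι) : ℕ :=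
  Module.finrank ℝ (Submodule.span ℝ (a '' (B : Set ι)))

/-- The multiplicity `m(B)` of `B` with respect to the lattice `L ⊆ V`: the index of `ℤB` as a
sublattice of `span B ∩ L`. -/
def latticeMult (L : Submodule ℤ V) (a : ι → V) (B : Finset ι) : ℕ :=
  (Submodule.span ℤ (a '' (B : Set ι))).toAddSubgroup.relIndex
    ((Submodule.span ℝ (a '' (B : Set ι))).restrictScalars ℤ ⊓ L).toAddSubgroup

/-- The arithmetic Tutte polynomial
`M(x, y) = ∑_B m(B) (x - 1)^(r(A) - r(B)) (y - 1)^(|B| - r(B))`, the sum being over all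
subconfigurations `B` of `A`; the variable `x` is `X 0` and `y` is `X 1`. Neither of the natural
subtractions truncates, because `r(B) ≤ r(A)` and `r(B) ≤ |B|`. -/
def tutte [Fintype ι] (L : Submodule ℤ V) (a : ι → V) : MvPolynomial (Fin 2) ℤ :=
  ∑ B : Finset ι, (latticeMult L a B : MvPolynomial (Fin 2) ℤ) *
    (MvPolynomial.X 0 - 1) ^ (rank a Finset.univ - rank a B) *
    (MvPolynomial.X 1 - 1) ^ (B.card - rank a B)

/-- The arithmetic characteristic polynomial `χ(q) = (-1)^r q^(N - r) M(1 - q, 0)`, where `N` is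
the rank of the lattice `L` and `r` the rank of the configuration; the variable `q` is `X`. -/
def charPoly [Fintype ι] (L : Submodule ℤ V) (a : ι → V) : ℤ[X] :=
  (-1) ^ rank a Finset.univ * Polynomial.X ^ (Module.finrank ℤ L - rank a Finset.univ) *
    MvPolynomial.aeval ![1 - Polynomial.X, 0] (tutte L a)

end General

/-- The ambient real vector space `ℝⁿ / ℝ(1, …, 1)` of the weight lattice of `A_{n-1}`. -/
abbrev WeightSpace (n : ℕ) : Type :=
  (Fin n → ℝ) ⧸ Submodule.span ℝ {(fun _ => 1 : Fin n → ℝ)}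

/-- The image in `ℝⁿ / ℝ(1, …, 1)` of the standard basis vector `e_i`. -/
def e {n : ℕ} (i : Fin n) : WeightSpace n :=
  Submodule.Quotient.mk (Pi.single i 1)

/-- The weight lattice `Λ_W(A_{n-1}) = ℤ{e_1, …, e_n} / (∑ e_i = 0)`. -/
def weightLattice (n : ℕ) : Submodule ℤ (WeightSpace n) :=
  Submodule.span ℤ (Set.range (e (n := n)))

/-- The positive roots `e_i - e_j`, `i < j`, of `A_{n-1}`. -/
def rootsA (n : ℕ) (p : {p : Fin n × Fin n // p.1 < p.2}) : WeightSpace n :=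
  e p.1.1 - e p.1.2

/-- The arithmetic characteristic polynomial of `A_{n-1}` in its weight lattice. -/
def charPolyWeightA (n : ℕ) : ℤ[X] :=
  charPoly (weightLattice n) (rootsA n)

/-- The multiset of the lengths of all cycles of `π`, fixed points counting as cycles of
length one. -/
def cycleLengths {n : ℕ} (π : Equiv.Perm (Fin n)) : Multiset ℕ :=
  π.partition.parts

/-- The permutations of `[n]` with exactly `k` cycles (fixed points included). -/
def permsWithCycles (n k : ℕ) : Finset (Equiv.Perm (Fin n)) :=
  {π | (cycleLengths π).card = k}

/-- `c_k`: the sum, over the permutations of `[n]` with `k` cycles, of the greatest common divisor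
of the cycle lengths. -/
def gcdSum (n k : ℕ) : ℕ :=
  ∑ π ∈ permsWithCycles n k, (cycleLengths π).gcd

end ArithTutte

end

noncomputable section

namespace ArithTutte

/-! ### Signed sums over graphs and over permutations, compared on the partition lattice. -/

section Combinatorics

open scoped Classical

variable {α : Type*}

/-! A set `B` of positive roots is a graph on `[n]`. Its rank is `n` minus the number of components,
and its multiplicity is the gcd `g` of the component sizes (`latticeMult_rootsA`): a lattice point
lies in the real span when its block sums are `t` times the block sizes, which allows exactly `t ∈
(1/g)ℤ`, and in the integer span when `t ∈ ℤ`. Hence `χ` is the sum over graphs of `(-1)^|B|` times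
a weight depending only on the partition into components.

Such a sum equals the signed sum over permutations of the same weight on cycle partitions
(`sum_graph_eq_sum_perm`). Restricted to partitions below `s`, both signed counts are `1` for `s =
⊥` and `0` otherwise, so by Möbius inversion they agree partition by partition. Finally, a
permutation with `k` cycles has sign `(-1)^(n-k)`. -/

theorem sum_le_eq_sum_fiber_add {L β : Type*} [PartialOrder L] [Fintype L] [Fintype β]
    (P : β → L) (f : β → ℤ) (s : L) :
    ∑ b with P b ≤ s, f b =
      ∑ b with P b = s, f b + ∑ t with t < s, ∑ b with P b = t, f b := by
  have e1 : ∑ t with t < s, ∑ b with P b = t, f b = ∑ b with P b < s, f b := by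
    simp only [Finset.sum_filter]
    rw [← Finset.sum_filter, Finset.sum_comm]
    refine Finset.sum_congr rfl fun b _ => ?_
    rw [Finset.sum_ite_eq]
    simp
  rw [e1, ← Finset.sum_union]
  · refine Finset.sum_congr ?_ fun _ _ => rfl
    ext b
    simp [le_iff_eq_or_lt]
  · rw [Finset.disjoint_filter]
    intro b _ hb
    simp [hb]

/-- Two families of weights indexed over a finite poset have the same fibre sums as soon as they
have the same sums over all principal lower sets. -/
theorem sum_fiber_eq_of_sum_le_eq {L β γ : Type*} [PartialOrder L] [Finite L] [Fintype β]
    [Fintype γ] (P : β → L) (Q : γ → L) (f : β → ℤ) (g : γ → ℤ)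
    (h : ∀ s, ∑ b with P b ≤ s, f b = ∑ c with Q c ≤ s, g c) (s : L) :
    ∑ b with P b = s, f b = ∑ c with Q c = s, g c := by
  have := Fintype.ofFinite L
  induction s using WellFoundedLT.induction with
  | ind s ih =>
    have h1 := h s
    rw [sum_le_eq_sum_fiber_add P f s, sum_le_eq_sum_fiber_add Q g s, Finset.sum_congr rfl fun t ht =>
      ih t (Finset.mem_filter.mp ht).2] at h1
    exact add_right_cancel h1

theorem sum_mul_comp_eq_of_sum_le_eq {L β γ R : Type*} [CommRing R] [PartialOrder L] [Finite L]
    [Fintype β] [Fintype γ] (P : β → L) (Q : γ → L) (f : β → ℤ) (g : γ → ℤ)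
    (h : ∀ s, ∑ b with P b ≤ s, f b = ∑ c with Q c ≤ s, g c) (w : L → R) :
    ∑ b, (f b : R) * w (P b) = ∑ c, (g c : R) * w (Q c) := by
  have := Fintype.ofFinite L
  rw [← Finset.sum_fiberwise Finset.univ P, ← Finset.sum_fiberwise Finset.univ Q]
  refine Finset.sum_congr rfl fun s _ => ?_
  have h1 := congrArg (fun z : ℤ => (z : R) * w s) (sum_fiber_eq_of_sum_le_eq P Q f g h s)
  simp only [Int.cast_sum, Finset.sum_mul] at h1
  convert h1 using 1 <;>
  · refine Finset.sum_congr rfl fun b hb => ?_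
    rw [(Finset.mem_filter.mp hb).2]

/-- The partition into connected components of the graph with edge set `B`. -/
def components [LT α] (B : Finset {p : α × α // p.1 < p.2}) : Setoid α :=
  Relation.EqvGen.setoid fun i j => ∃ p ∈ B, p.1 = (i, j)

theorem components_rel [LT α] {B : Finset {p : α × α // p.1 < p.2}} {p : {p : α × α // p.1 < p.2}}
    (hp : p ∈ B) : components B p.1.1 p.1.2 :=
  Relation.EqvGen.rel _ _ ⟨p, hp, rfl⟩

theorem components_le_iff [LT α] (B : Finset {p : α × α // p.1 < p.2}) (s : Setoid α) :
    components B ≤ s ↔ ∀ p ∈ B, s p.1.1 p.1.2 := by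
  refine ⟨fun h p hp => h (components_rel hp), fun h => Setoid.eqvGen_le ?_⟩
  rintro x y ⟨p, hp, hxy⟩
  have := h p hp
  rwa [hxy] at this

theorem sameCycle_setoid_le_iff (π : Equiv.Perm α) (s : Setoid α) :
    Equiv.Perm.SameCycle.setoid π ≤ s ↔ ∀ x, s x (π x) := by
  constructor
  · intro h x
    exact h (Equiv.Perm.sameCycle_apply_right.mpr (Equiv.Perm.SameCycle.refl π x))
  · rintro h x y ⟨k, rfl⟩
    induction k using Int.induction_on with
    | zero => exact s.refl x
    | succ k ih =>
      rw [add_comm, zpow_add, zpow_one]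
      exact s.trans ih (h _)
    | pred k ih =>
      refine s.trans ih (s.symm ?_)
      have := h ((π ^ (-(k : ℤ) - 1)) x)
      rwa [← Equiv.Perm.mul_apply, ← zpow_one_add, add_sub_cancel] at this

theorem exists_rel_ne_of_ne_bot {s : Setoid α} (hs : s ≠ ⊥) : ∃ i j, i ≠ j ∧ s i j := by
  by_contra! h
  refine hs (eq_bot_iff.mpr fun i j hij => ?_)
  by_contra hne
  exact h i j hne hij

/-- The graphs in question are all subsets of the edges inside blocks of `s`, so the alternating sum
vanishes unless there are no such edges. -/
theorem sum_edges_le [Fintype α] [LinearOrder α] (s : Setoid α) :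
    ∑ B : Finset {p : α × α // p.1 < p.2} with components B ≤ s, (-1 : ℤ) ^ B.card =
      if s = ⊥ then 1 else 0 := by
  have h1 : (Finset.univ.filter fun B : Finset {p : α × α // p.1 < p.2} => components B ≤ s) =
      (Finset.univ.filter fun p : {p : α × α // p.1 < p.2} => s p.1.1 p.1.2).powerset := by
    ext B
    simp [components_le_iff, Finset.subset_iff]
  rw [h1, Finset.sum_powerset_neg_one_pow_card]
  refine if_congr ?_ rfl rfl
  rw [Finset.filter_eq_empty_iff]
  constructor
  · intro h
    by_contra hs
    obtain ⟨i, j, hne, hij⟩ := exists_rel_ne_of_ne_bot hs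
    rcases lt_or_gt_of_ne hne with hlt | hlt
    · exact h (Finset.mem_univ ⟨(i, j), hlt⟩) hij
    · exact h (Finset.mem_univ ⟨(j, i), hlt⟩) (s.symm hij)
  · rintro rfl p _ hp
    exact p.2.ne hp

/-- If two distinct points are related, multiplying by their transposition is a sign-reversing
involution without fixed points. -/
theorem sum_sign_le [Fintype α] [DecidableEq α] (s : Setoid α) :
    ∑ π : Equiv.Perm α with Equiv.Perm.SameCycle.setoid π ≤ s,
      ((Equiv.Perm.sign π : ℤˣ) : ℤ) = if s = ⊥ then 1 else 0 := by
  simp only [sameCycle_setoid_le_iff]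
  split_ifs with hs
  · have hbot : ∀ x y, s x y → x = y := fun x y h => by subst hs; exact h
    rw [Finset.sum_eq_single 1]
    · simp
    · intro π hπ hne
      rw [Finset.mem_filter] at hπ
      refine absurd (Equiv.ext fun x => ?_) hne
      exact (hbot _ _ (hπ.2 x)).symm
    · intro h
      refine absurd ?_ h
      rw [Finset.mem_filter]
      exact ⟨Finset.mem_univ _, fun x => s.refl x⟩
  · obtain ⟨i, j, hne, hij⟩ := exists_rel_ne_of_ne_bot hs
    have hswap : ∀ x, s x (Equiv.swap i j x) := by
      intro x
      by_cases hi : x = i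
      · subst hi
        simpa using hij
      · by_cases hj : x = j
        · subst hj
          simpa using s.symm hij
        · rw [Equiv.swap_apply_of_ne_of_ne hi hj]
    refine Finset.sum_involution (fun π _ => Equiv.swap i j * π) ?_ ?_ ?_ ?_
    · intro π _
      simp [Equiv.Perm.sign_swap hne]
    · intro π _ _ h
      exact hne (Equiv.swap_eq_one_iff.mp (mul_eq_right.mp h))
    · intro π hπ
      refine Finset.mem_filter.mpr ⟨Finset.mem_univ _, fun x => ?_⟩
      exact s.trans ((Finset.mem_filter.mp hπ).2 x) (hswap _)
    · intro π _
      simp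

instance [Finite α] : Finite (Setoid α) :=
  Finite.of_injective (fun s : Setoid α => s.r) fun _ _ h =>
    Setoid.ext fun a b => iff_of_eq (congrFun (congrFun h a) b)

/-- The alternating sum over all graphs of a function of the components equals the signed sum over
all permutations of the same function of the cycle partition. -/
theorem sum_graph_eq_sum_perm [Fintype α] [LinearOrder α] {R : Type*} [CommRing R]
    (w : Setoid α → R) :
    ∑ B : Finset {p : α × α // p.1 < p.2}, (-1) ^ B.card * w (components B) =
      ∑ π : Equiv.Perm α, (((Equiv.Perm.sign π : ℤˣ) : ℤ) : R) *
        w (Equiv.Perm.SameCycle.setoid π) := by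
  rw [← sum_mul_comp_eq_of_sum_le_eq components _ (fun B => (-1) ^ B.card) _
    (fun s => (sum_edges_le s).trans (sum_sign_le s).symm) w]
  simp

/-- The size of a block of a partition. -/
def blockSize [Fintype α] (s : Setoid α) (c : Quotient s) : ℕ :=
  (Finset.univ.filter fun i => Quotient.mk s i = c).card

theorem sum_blockSize [Fintype α] (s : Setoid α) : ∑ c, blockSize s c = Fintype.card α := by
  rw [← Finset.card_univ]
  exact (Finset.card_eq_sum_card_fiberwise fun _ _ => Finset.mem_univ _).symm

theorem blockSize_pos [Fintype α] (s : Setoid α) (c : Quotient s) : 0 < blockSize s c :=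
  Finset.card_pos.mpr ⟨c.out, by simp⟩

/-- The greatest common divisor of the sizes of the blocks of a partition. -/
def blockGcd [Fintype α] (s : Setoid α) : ℕ :=
  Finset.univ.gcd (blockSize s)

/-- `partition` is the cycle type padded with ones. Classes on which `F` is nontrivial match the
cycle factors; the others are fixed points, and comparing total sizes shows that their number is the
padding. -/
theorem partition_parts_eq_map_blockSize [Fintype α] [DecidableEq α] (π : Equiv.Perm α) :
    π.partition.parts =
      Finset.univ.val.map (blockSize (Equiv.Perm.SameCycle.setoid π)) := by
  set s := Equiv.Perm.SameCycle.setoid π with hs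
  set F : Quotient s → Equiv.Perm α :=
    Quotient.lift (fun x => π.cycleOf x) fun _ _ h => Equiv.Perm.SameCycle.cycleOf_eq h with hF
  have hFmk : ∀ x, F (Quotient.mk s x) = π.cycleOf x := fun x => rfl
  have hmk : ∀ x y, Quotient.mk s x = Quotient.mk s y ↔ π.SameCycle x y := fun x y => Quotient.eq
  have himage : (Finset.univ.filter fun c => F c ≠ 1).image F = π.cycleFactorsFinset := by
    ext σ
    simp only [Finset.mem_image, Finset.mem_filter, Finset.mem_univ, true_and]
    constructor
    · rintro ⟨c, hc, rfl⟩
      induction c using Quotient.inductionOn with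
      | h x =>
        rw [hFmk] at hc ⊢
        rw [Equiv.Perm.cycleOf_mem_cycleFactorsFinset_iff, Equiv.Perm.mem_support]
        rwa [ne_eq, Equiv.Perm.cycleOf_eq_one_iff] at hc
    · intro hσ
      have hcyc := (Equiv.Perm.mem_cycleFactorsFinset_iff.mp hσ).1
      obtain ⟨x, hx⟩ := hcyc.nonempty_support
      have := Equiv.Perm.cycle_is_cycleOf hx hσ
      refine ⟨Quotient.mk s x, ?_, this.symm⟩
      rw [hFmk, ← this]
      exact hcyc.ne_one
  have hinj : Set.InjOn F (Finset.univ.filter fun c => F c ≠ 1 : Finset (Quotient s)) := by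
    intro c hc d hd hcd
    induction c using Quotient.inductionOn with
    | h x =>
      induction d using Quotient.inductionOn with
      | h y =>
        have hc' := (Finset.mem_filter.mp (Finset.mem_coe.mp hc)).2
        rw [hFmk, ne_eq, Equiv.Perm.cycleOf_eq_one_iff] at hc'
        rw [hFmk, hFmk] at hcd
        rw [hmk]
        have hx : x ∈ (π.cycleOf x).support :=
          Equiv.Perm.mem_support_cycleOf_iff.mpr
            ⟨Equiv.Perm.SameCycle.refl _ _, Equiv.Perm.mem_support.mpr hc'⟩
        rw [hcd] at hx
        exact (Equiv.Perm.mem_support_cycleOf_iff.mp hx).1.symm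
  have hsupp : ∀ c, F c ≠ 1 → (F c).support.card = blockSize s c := by
    intro c hc
    induction c using Quotient.inductionOn with
    | h x =>
      rw [hFmk, ne_eq, Equiv.Perm.cycleOf_eq_one_iff] at hc
      rw [hFmk, blockSize]
      congr 1
      ext y
      rw [Equiv.Perm.mem_support_cycleOf_iff' hc]
      simp only [Finset.mem_filter, Finset.mem_univ, true_and]
      rw [hmk, Equiv.Perm.sameCycle_comm]
  have hone : ∀ c, F c = 1 → blockSize s c = 1 := by
    intro c hc
    induction c using Quotient.inductionOn with
    | h x =>
      rw [hFmk, Equiv.Perm.cycleOf_eq_one_iff] at hc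
      rw [blockSize, Finset.card_eq_one]
      refine ⟨x, ?_⟩
      ext y
      simp only [Finset.mem_filter, Finset.mem_univ, true_and, Finset.mem_singleton]
      rw [hmk]
      refine ⟨fun h => ?_, fun h => h ▸ Equiv.Perm.SameCycle.refl _ _⟩
      exact (h.symm.eq_of_left hc).symm
  have htype : π.cycleType =
      (Finset.univ.filter fun c => F c ≠ 1).val.map (blockSize s) := by
    rw [Equiv.Perm.cycleType_def, ← himage, Finset.image_val_of_injOn hinj, Multiset.map_map]
    refine Multiset.map_congr rfl fun c hc => ?_
    exact hsupp c (Finset.mem_filter.mp (Finset.mem_val.mp hc)).2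
  have hrest : (Finset.univ.filter fun c => ¬ F c ≠ 1).val.map (blockSize s) =
      Multiset.replicate (Finset.univ.filter fun c => ¬ F c ≠ 1).card 1 := by
    rw [Finset.card_def, ← Multiset.map_const']
    refine Multiset.map_congr rfl fun c hc => ?_
    exact hone c (not_not.mp (Finset.mem_filter.mp (Finset.mem_val.mp hc)).2)
  have hcard : (Finset.univ.filter fun c => ¬ F c ≠ 1).card =
      Fintype.card α - π.support.card := by
    have h1 := sum_blockSize s
    rw [← Finset.sum_filter_add_sum_filter_not Finset.univ (fun c => F c ≠ 1)] at h1
    have h2 := congrArg Multiset.sum hrest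
    have h3 := π.sum_cycleType
    rw [htype] at h3
    simp only [Multiset.sum_replicate, smul_eq_mul, mul_one] at h2
    change (∑ c with F c ≠ 1, blockSize s c) = _ at h3
    change (∑ c with ¬ F c ≠ 1, blockSize s c) = _ at h2
    omega
  rw [Equiv.Perm.parts_partition, htype, ← hcard, ← hrest, ← Multiset.map_add]
  congr 1
  simp only [Finset.filter_val]
  exact Multiset.filter_add_not _ _

end Combinatorics

/-! ### Block sums, and edge spans as their kernels. -/

section BlockSums

open scoped Classical

variable {α : Type*} [Fintype α] (R : Type*) [CommRing R]

/-- The linear map taking a vector to its sums over the blocks of a partition. -/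
def blockSum (s : Setoid α) : (α → R) →ₗ[R] (Quotient s → R) where
  toFun x c := ∑ i with Quotient.mk s i = c, x i
  map_add' x y := by ext c; simp [Finset.sum_add_distrib]
  map_smul' a x := by ext c; simp [Finset.mul_sum]

theorem blockSum_apply (s : Setoid α) (x : α → R) (c : Quotient s) :
    blockSum R s x c = ∑ i with Quotient.mk s i = c, x i := rfl

theorem blockSum_single (s : Setoid α) (i : α) (a : R) :
    blockSum R s (Pi.single i a) = Pi.single (Quotient.mk s i) a := by
  ext c
  rw [blockSum_apply, Finset.sum_filter, Finset.sum_eq_single i]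
  · simp [Pi.single_apply, eq_comm]
  · intro j _ hj
    simp [hj]
  · simp

theorem blockSum_const (s : Setoid α) (a : R) (c : Quotient s) :
    blockSum R s (fun _ => a) c = a * blockSize s c := by
  rw [blockSum_apply, Finset.sum_const, nsmul_eq_mul, mul_comm, blockSize]

theorem blockSum_surjective (s : Setoid α) : Function.Surjective (blockSum R s) := by
  intro y
  refine ⟨∑ c, Pi.single c.out (y c), ?_⟩
  rw [map_sum]
  simp only [blockSum_single, Quotient.out_eq]
  exact Finset.univ_sum_single y

/-- The vector `δ_i - δ_j` attached to an edge `(i, j)`. -/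
def edgeVec [LT α] (p : {p : α × α // p.1 < p.2}) : α → R :=
  Pi.single p.1.1 1 - Pi.single p.1.2 1

/-- Subtracting from each `δ_i` the delta at its block's representative does not change a vector
with zero block sums. No division occurs, so this serves both `ℤ` and `ℝ`. -/
theorem span_edgeVec_eq_ker_blockSum [LT α] (B : Finset {p : α × α // p.1 < p.2}) :
    Submodule.span R (edgeVec R '' (B : Set {p : α × α // p.1 < p.2})) =
      LinearMap.ker (blockSum R (components B)) := by
  apply le_antisymm
  · rw [Submodule.span_le]
    rintro _ ⟨p, hp, rfl⟩
    rw [SetLike.mem_coe, LinearMap.mem_ker, edgeVec, map_sub, blockSum_single, blockSum_single,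
      Quotient.sound (components_rel hp), sub_self]
  · intro x hx
    set W := Submodule.span R (edgeVec R '' (B : Set {p : α × α // p.1 < p.2})) with hW
    have hrel : ∀ i j, components B i j → (Pi.single i 1 - Pi.single j 1 : α → R) ∈ W := by
      intro i j hij
      induction hij with
      | rel i j h =>
        obtain ⟨p, hp, hpe⟩ := h
        have : edgeVec R p ∈ W := Submodule.subset_span ⟨p, hp, rfl⟩
        rwa [edgeVec, hpe] at this
      | refl i => simp
      | symm i j _ ih => rw [← neg_sub]; exact W.neg_mem ih
      | trans i j k _ _ ih1 ih2 =>
        rw [← sub_add_sub_cancel _ (Pi.single j 1 : α → R)]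
        exact W.add_mem ih1 ih2
    have hdecomp : x = ∑ i, x i • (Pi.single i 1 -
        Pi.single (Quotient.mk (components B) i).out 1 : α → R) := by
      simp only [smul_sub, Finset.sum_sub_distrib]
      have h1 : ∑ i, x i • (Pi.single (Quotient.mk (components B) i).out 1 : α → R) = 0 := by
        rw [← Finset.sum_fiberwise Finset.univ (Quotient.mk (components B))]
        refine Finset.sum_eq_zero fun c _ => ?_
        rw [Finset.sum_congr rfl (g := fun i => x i • (Pi.single c.out 1 : α → R)),
          ← Finset.sum_smul]
        · have := congrFun (LinearMap.mem_ker.mp hx) c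
          rw [blockSum_apply] at this
          rw [this]
          simp
        · intro i hi
          rw [(Finset.mem_filter.mp hi).2]
      rw [h1, sub_zero]
      exact pi_eq_sum_univ' x
    rw [hdecomp]
    exact W.sum_mem fun i _ => W.smul_mem _ (hrel _ _
      (Quotient.exact (Quotient.out_eq (Quotient.mk (components B) i)).symm))

theorem finrank_ker_blockSum (K : Type*) [Field K] (s : Setoid α) :
    Module.finrank K (LinearMap.ker (blockSum K s)) + Fintype.card (Quotient s) =
      Fintype.card α := by
  have h := LinearMap.finrank_range_add_finrank_ker (blockSum K s)
  rw [LinearMap.range_eq_top.mpr (blockSum_surjective K s), finrank_top, Module.finrank_pi,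
    Module.finrank_pi] at h
  omega

theorem blockGcd_pos [Nonempty α] (s : Setoid α) : 0 < blockGcd s := by
  refine Nat.pos_of_ne_zero (Finset.gcd_ne_zero_iff.mpr ?_)
  exact ⟨Quotient.mk s (Classical.arbitrary α), Finset.mem_univ _, (blockSize_pos s _).ne'⟩

theorem blockGcd_dvd (s : Setoid α) (c : Quotient s) : blockGcd s ∣ blockSize s c :=
  Finset.gcd_dvd (Finset.mem_univ c)

theorem exists_sum_mul_blockSize_eq_blockGcd (s : Setoid α) :
    ∃ l : Quotient s → ℤ, ∑ c, l c * blockSize s c = blockGcd s := by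
  obtain ⟨l, hl⟩ := Finset.gcd_eq_sum_mul (R := ℤ) Finset.univ (fun c => (blockSize s c : ℤ))
  have h : (Finset.univ.gcd fun c => (blockSize s c : ℤ)) = blockGcd s := by
    refine Int.dvd_antisymm Finset.Int.finsetGcd_nonneg (Int.natCast_nonneg _) ?_ ?_
    · rw [← Int.natAbs_dvd, Int.natCast_dvd_natCast]
      refine Finset.dvd_gcd fun c hc => ?_
      rw [← Int.natCast_dvd_natCast, Int.natAbs_dvd]
      exact Finset.gcd_dvd hc
    · exact Finset.dvd_gcd fun c _ => Int.natCast_dvd_natCast.mpr (blockGcd_dvd s c)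
  refine ⟨l, ?_⟩
  rw [← h, hl]
  exact Finset.sum_congr rfl fun c _ => mul_comm _ _

end BlockSums

/-! ### Rank and multiplicity of a graph in the weight lattice. -/

section WeightLattice

open scoped Classical

variable {n : ℕ}

/-- The map `ℤⁿ → ℝⁿ / ℝ(1, …, 1)`, whose image is the weight lattice. -/
def latticeMap (n : ℕ) : (Fin n → ℤ) →ₗ[ℤ] WeightSpace n :=
  Fintype.linearCombination ℤ (e (n := n))

theorem range_latticeMap : LinearMap.range (latticeMap n) = weightLattice n :=
  Fintype.range_linearCombination ℤ e

theorem latticeMap_apply (x : Fin n → ℤ) :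
    latticeMap n x = Submodule.Quotient.mk (fun i => (x i : ℝ)) := by
  rw [latticeMap, Fintype.linearCombination_apply]
  conv_rhs => rw [pi_eq_sum_univ' (fun i => (x i : ℝ)), ← Submodule.mkQ_apply, map_sum]
  refine Finset.sum_congr rfl fun i _ => ?_
  rw [map_smul, e, Submodule.mkQ_apply, Int.cast_smul_eq_zsmul]

theorem mk_eq_mk_iff (x y : Fin n → ℝ) :
    (Submodule.Quotient.mk x : WeightSpace n) = Submodule.Quotient.mk y ↔
      ∃ t : ℝ, ∀ i, x i = y i + t := by
  rw [Submodule.Quotient.eq, Submodule.mem_span_singleton]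
  refine exists_congr fun t => ?_
  rw [funext_iff]
  refine forall_congr' fun i => ?_
  simp only [Pi.smul_apply, smul_eq_mul, mul_one, Pi.sub_apply]
  constructor <;> intro h <;> linarith

theorem latticeMap_eq_iff [NeZero n] (x y : Fin n → ℤ) :
    latticeMap n x = latticeMap n y ↔ ∃ t : ℤ, ∀ i, x i = y i + t := by
  rw [latticeMap_apply, latticeMap_apply, mk_eq_mk_iff]
  constructor
  · rintro ⟨t, ht⟩
    refine ⟨x 0 - y 0, fun i => ?_⟩
    have h0 := ht 0
    have hi := ht i
    have : (x i : ℝ) = y i + (x 0 - y 0) := by rw [hi, h0]; ring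
    exact_mod_cast this
  · rintro ⟨t, ht⟩
    exact ⟨t, fun i => by rw [ht i]; push_cast; rfl⟩

theorem rootsA_eq_mk (p : {p : Fin n × Fin n // p.1 < p.2}) :
    rootsA n p = (Submodule.span ℝ {(fun _ => 1 : Fin n → ℝ)}).mkQ (edgeVec ℝ p) := by
  rw [rootsA, edgeVec, map_sub, e, e, Submodule.mkQ_apply, Submodule.mkQ_apply]
  congr!

theorem rootsA_eq_latticeMap (p : {p : Fin n × Fin n // p.1 < p.2}) :
    rootsA n p = latticeMap n (edgeVec ℤ p) := by
  rw [rootsA, edgeVec, map_sub, latticeMap, Fintype.linearCombination_apply_single,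
    Fintype.linearCombination_apply_single, one_smul, one_smul]

theorem span_real_rootsA (B : Finset {p : Fin n × Fin n // p.1 < p.2}) :
    Submodule.span ℝ (rootsA n '' (B : Set {p : Fin n × Fin n // p.1 < p.2})) =
      (LinearMap.ker (blockSum ℝ (components B))).map
        (Submodule.span ℝ {(fun _ => 1 : Fin n → ℝ)}).mkQ := by
  rw [← span_edgeVec_eq_ker_blockSum, Submodule.map_span, ← Set.image_comp]
  congr 1
  exact Set.image_congr fun p _ => rootsA_eq_mk p

theorem span_int_rootsA (B : Finset {p : Fin n × Fin n // p.1 < p.2}) :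
    Submodule.span ℤ (rootsA n '' (B : Set {p : Fin n × Fin n // p.1 < p.2})) =
      (LinearMap.ker (blockSum ℤ (components B))).map (latticeMap n) := by
  rw [← span_edgeVec_eq_ker_blockSum, Submodule.map_span, ← Set.image_comp]
  congr 1
  exact Set.image_congr fun p _ => rootsA_eq_latticeMap p

/-- No dimension is lost in the quotient: a constant vector with zero block sums is zero, since
blocks are nonempty. -/
theorem rank_rootsA [NeZero n] (B : Finset {p : Fin n × Fin n // p.1 < p.2}) :
    rank (rootsA n) B + Fintype.card (Quotient (components B)) = n := by
  have h := finrank_ker_blockSum ℝ (components B)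
  rw [Fintype.card_fin] at h
  rw [rank, span_real_rootsA, ← LinearMap.range_domRestrict, LinearMap.finrank_range_of_inj, h]
  rw [← LinearMap.ker_eq_bot, LinearMap.ker_eq_bot']
  rintro ⟨x, hx⟩ h0
  rw [LinearMap.domRestrict_apply, Submodule.mkQ_apply, Submodule.Quotient.mk_eq_zero,
    Submodule.mem_span_singleton] at h0
  obtain ⟨t, rfl⟩ := h0
  have h1 := congrFun (LinearMap.mem_ker.mp hx) (Quotient.mk _ 0)
  have h2 : (t • (fun _ => 1 : Fin n → ℝ)) = fun _ => t := by ext; simp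
  rw [h2, blockSum_const, Pi.zero_apply, mul_eq_zero, Nat.cast_eq_zero] at h1
  have ht : t = 0 := h1.resolve_right (blockSize_pos _ _).ne'
  simp [ht]

/-- An upper bound suffices: it already makes the truncated exponent `N - r` of `charPoly` zero. -/
theorem finrank_weightLattice_le [NeZero n] : Module.finrank ℤ (weightLattice n) ≤ n - 1 := by
  have h := Submodule.finrank_quotient_add_finrank (LinearMap.ker (latticeMap n))
  rw [(latticeMap n).quotKerEquivRange.finrank_eq, range_latticeMap, Module.finrank_pi, Fintype.card_fin] at h
  have hmem : (fun _ => 1 : Fin n → ℤ) ∈ LinearMap.ker (latticeMap n) := by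
    rw [LinearMap.mem_ker, ← map_zero (latticeMap n), latticeMap_eq_iff]
    exact ⟨1, fun i => by simp⟩
  have hpos : 0 < Module.finrank ℤ (LinearMap.ker (latticeMap n)) := by
    rw [Module.finrank_pos_iff]
    exact ⟨⟨⟨_, hmem⟩, 0, fun h => one_ne_zero (congrFun (congrArg Subtype.val h) 0)⟩⟩
  omega

/-- The parameter `t` is the multiple of `(1, …, 1)` by which `x` differs from a vector with zero
block sums. -/
theorem latticeMap_mem_span_real_iff (B : Finset {p : Fin n × Fin n // p.1 < p.2})
    (x : Fin n → ℤ) :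
    latticeMap n x ∈
        Submodule.span ℝ (rootsA n '' (B : Set {p : Fin n × Fin n // p.1 < p.2})) ↔
      ∃ t : ℝ, ∀ c, (blockSum ℤ (components B) x c : ℝ) = t * blockSize (components B) c := by
  have hcast : ∀ c, blockSum ℝ (components B) (fun i => (x i : ℝ)) c =
      blockSum ℤ (components B) x c := fun c => by simp [blockSum_apply]
  rw [span_real_rootsA, latticeMap_apply]
  constructor
  · rintro ⟨y, hy, hyx⟩
    obtain ⟨t, ht⟩ := (mk_eq_mk_iff _ _).mp hyx.symm
    refine ⟨t, fun c => ?_⟩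
    have h1 : (fun i => (x i : ℝ)) = y + fun _ => t := funext ht
    rw [← hcast, h1, map_add, LinearMap.mem_ker.mp hy, zero_add, blockSum_const]
  · rintro ⟨t, ht⟩
    refine ⟨(fun i => (x i : ℝ)) - fun _ => t, ?_, ?_⟩
    · rw [SetLike.mem_coe, LinearMap.mem_ker, map_sub]
      ext c
      rw [Pi.sub_apply, hcast, blockSum_const, ht, sub_self, Pi.zero_apply]
    · exact ((mk_eq_mk_iff _ _).mpr ⟨t, fun i => by simp⟩).symm

theorem latticeMap_mem_span_int_iff [NeZero n] (B : Finset {p : Fin n × Fin n // p.1 < p.2})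
    (x : Fin n → ℤ) :
    latticeMap n x ∈
        Submodule.span ℤ (rootsA n '' (B : Set {p : Fin n × Fin n // p.1 < p.2})) ↔
      ∃ t : ℤ, ∀ c, blockSum ℤ (components B) x c = t * blockSize (components B) c := by
  rw [span_int_rootsA]
  constructor
  · rintro ⟨y, hy, hyx⟩
    obtain ⟨t, ht⟩ := (latticeMap_eq_iff _ _).mp hyx.symm
    refine ⟨t, fun c => ?_⟩
    have h1 : x = y + fun _ => t := funext ht
    rw [h1, map_add, LinearMap.mem_ker.mp hy, zero_add, blockSum_const]
  · rintro ⟨t, ht⟩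
    refine ⟨x - fun _ => t, ?_, ?_⟩
    · rw [SetLike.mem_coe, LinearMap.mem_ker, map_sub]
      ext c
      rw [Pi.sub_apply, blockSum_const, ht, sub_self, Pi.zero_apply]
    · exact ((latticeMap_eq_iff _ _).mpr ⟨t, fun i => by simp⟩).symm

/-- The multiplicity of a graph in the weight lattice is the greatest common divisor of the sizes
of its components. -/
theorem latticeMult_rootsA [NeZero n] (B : Finset {p : Fin n × Fin n // p.1 < p.2}) :
    latticeMult (weightLattice n) (rootsA n) B = blockGcd (components B) := by
  set s := components B with hs
  set H := (Submodule.span ℤ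
    (rootsA n '' (B : Set {p : Fin n × Fin n // p.1 < p.2}))).toAddSubgroup with hH
  set K := ((Submodule.span ℝ
    (rootsA n '' (B : Set {p : Fin n × Fin n // p.1 < p.2}))).restrictScalars ℤ ⊓ weightLattice n).toAddSubgroup with hK
  set f : (Fin n → ℤ) →+ WeightSpace n := (latticeMap n).toAddMonoidHom with hf
  have hmapK : (K.comap f).map f = K := by
    refine AddSubgroup.map_comap_eq_self ?_
    rintro v ⟨_, hv⟩
    rw [SetLike.mem_coe, ← range_latticeMap] at hv
    exact hv
  have hKmem : ∀ x, x ∈ K.comap f ↔ ∃ t : ℝ, ∀ c, (blockSum ℤ s x c : ℝ) = t * blockSize s c := by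
    intro x
    rw [← latticeMap_mem_span_real_iff B x]
    refine ⟨fun h => h.1, fun h => ⟨h, ?_⟩⟩
    rw [SetLike.mem_coe, ← range_latticeMap]
    exact ⟨x, rfl⟩
  have hHmem : ∀ x, x ∈ H.comap f ↔ ∃ t : ℤ, ∀ c, blockSum ℤ s x c = t * blockSize s c :=
    latticeMap_mem_span_int_iff B
  obtain ⟨l, hl⟩ := exists_sum_mul_blockSize_eq_blockGcd s
  have hg : (blockGcd s : ℤ) ≠ 0 := by exact_mod_cast (blockGcd_pos s).ne'
  -- With Bézout coefficients `l`, `θ` takes the value `t * g` on points with parameter `t`, turning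
  -- the index into that of `gℤ` in `ℤ`.
  set θ : (Fin n → ℤ) →+ ℤ :=
    (Fintype.linearCombination ℤ l ∘ₗ blockSum ℤ s).toAddMonoidHom with hθ
  have hθ_apply : ∀ x, θ x = ∑ c, blockSum ℤ s x c * l c := fun x => rfl
  have hKθ : ∀ x ∈ K.comap f, ∀ c, blockGcd s * blockSum ℤ s x c = θ x * blockSize s c := by
    intro x hx c
    obtain ⟨t, ht⟩ := (hKmem x).mp hx
    have h1 : (θ x : ℝ) = t * blockGcd s := by
      have h2 : (blockGcd s : ℝ) = ∑ c, (l c : ℝ) * blockSize s c := by exact_mod_cast hl.symm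
      rw [hθ_apply, h2, Finset.mul_sum]
      push_cast
      refine Finset.sum_congr rfl fun c _ => ?_
      rw [ht]
      ring
    have h3 : (blockGcd s * blockSum ℤ s x c : ℝ) = θ x * blockSize s c := by
      rw [h1, ht]
      ring
    exact_mod_cast h3
  -- The intersection with `K` is needed: `θ` determines the block sums only there.
  have hinf : H.comap f ⊓ K.comap f =
      (AddSubgroup.zmultiples (blockGcd s : ℤ)).comap θ ⊓ K.comap f := by
    ext x
    rw [AddSubgroup.mem_inf, AddSubgroup.mem_inf]
    refine and_congr_left fun hx => ?_
    rw [hHmem, AddSubgroup.mem_comap, Int.mem_zmultiples_iff]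
    constructor
    · rintro ⟨t, ht⟩
      refine ⟨t, ?_⟩
      rw [hθ_apply, ← hl, Finset.sum_mul]
      refine Finset.sum_congr rfl fun c _ => ?_
      rw [ht]
      ring
    · rintro ⟨t, ht⟩
      refine ⟨t, fun c => mul_left_cancel₀ hg ?_⟩
      rw [hKθ x hx c, ht, mul_assoc]
  have hsurj : (K.comap f).map θ = ⊤ := by
    rw [eq_top_iff]
    intro m _
    -- These block sums are integral with parameter `t = m / g`, so `θ x = m`.
    obtain ⟨x, hx⟩ := blockSum_surjective ℤ s (fun c => m * (blockSize s c / blockGcd s))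
    have hdiv : ∀ c, (blockGcd s : ℤ) * (blockSize s c / blockGcd s) = blockSize s c := fun c =>
      Int.mul_ediv_cancel' (Int.natCast_dvd_natCast.mpr (blockGcd_dvd s c))
    refine ⟨x, ?_, ?_⟩
    · rw [SetLike.mem_coe, hKmem]
      refine ⟨m / blockGcd s, fun c => ?_⟩
      have hg' : (blockGcd s : ℝ) ≠ 0 := by exact_mod_cast hg
      rw [hx, div_mul_eq_mul_div, eq_div_iff hg']
      have : m * (blockSize s c / blockGcd s) * blockGcd s = m * (blockSize s c : ℤ) := by
        linear_combination m * hdiv c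
      exact_mod_cast this
    · refine mul_left_cancel₀ hg ?_
      rw [hθ_apply, Finset.mul_sum]
      conv_rhs => rw [← hl, Finset.sum_mul]
      refine Finset.sum_congr rfl fun c _ => ?_
      rw [hx]
      linear_combination m * l c * hdiv c
  change H.relIndex K = _
  rw [← hmapK, ← AddSubgroup.relIndex_comap, ← AddSubgroup.inf_relIndex_right, hinf,
    AddSubgroup.inf_relIndex_right, AddSubgroup.relIndex_comap, hsurj,
    AddSubgroup.relIndex_top_right, Int.index_zmultiples, Int.natAbs_natCast]

end WeightLattice

/-! ### Cycle statistics and evaluation of the characteristic polynomial. -/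

section Assembly

open scoped Classical

theorem card_cycleLengths {n : ℕ} (π : Equiv.Perm (Fin n)) :
    (cycleLengths π).card = Fintype.card (Quotient (Equiv.Perm.SameCycle.setoid π)) := by
  rw [cycleLengths, partition_parts_eq_map_blockSize, Multiset.card_map]
  rfl

theorem gcd_cycleLengths {n : ℕ} (π : Equiv.Perm (Fin n)) :
    (cycleLengths π).gcd = blockGcd (Equiv.Perm.SameCycle.setoid π) := by
  rw [cycleLengths, partition_parts_eq_map_blockSize]
  rfl

theorem sign_eq_neg_one_pow_sub_card_cycleLengths {n : ℕ} (π : Equiv.Perm (Fin n)) :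
    ((Equiv.Perm.sign π : ℤˣ) : ℤ) = (-1) ^ (n - (cycleLengths π).card) := by
  have h1 : π.support.card ≤ n := by simpa using π.support.card_le_univ
  have h2 : π.cycleType.card * 2 ≤ π.support.card := by
    rw [← π.sum_cycleType, ← smul_eq_mul]
    exact Multiset.card_nsmul_le_sum fun m hm => Equiv.Perm.two_le_of_mem_cycleType hm
  rw [Equiv.Perm.sign_of_cycleType, cycleLengths, Equiv.Perm.parts_partition, Multiset.card_add,
    Multiset.card_replicate, Fintype.card_fin, π.sum_cycleType]
  push_cast
  -- The sign exponent from the cycle type differs from `n - k` by an even number, as fixed points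
  -- count among the `k` cycles.
  have h3 : π.support.card + π.cycleType.card =
      n - (π.cycleType.card + (n - π.support.card)) + 2 * π.cycleType.card := by omega
  rw [h3, pow_add, pow_mul]
  simp

theorem card_cycleLengths_mem_Icc {n : ℕ} [NeZero n] (π : Equiv.Perm (Fin n)) :
    (cycleLengths π).card ∈ Finset.Icc 1 n := by
  rw [card_cycleLengths, Finset.mem_Icc]
  refine ⟨Fintype.card_pos_iff.mpr ⟨Quotient.mk _ 0⟩, ?_⟩
  simpa using Fintype.card_quotient_le (Equiv.Perm.SameCycle.setoid π)

theorem components_univ {n : ℕ} :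
    components (Finset.univ : Finset {p : Fin n × Fin n // p.1 < p.2}) = ⊤ := by
  refine eq_top_iff.mpr fun i j _ => ?_
  rcases lt_trichotomy i j with h | rfl | h
  · exact components_rel (Finset.mem_univ ⟨(i, j), h⟩)
  · exact Setoid.refl' _ i
  · exact Setoid.symm' _ (components_rel (Finset.mem_univ ⟨(j, i), h⟩))

theorem rank_rootsA_univ {n : ℕ} [NeZero n] : rank (rootsA n) Finset.univ = n - 1 := by
  have h := rank_rootsA (n := n) Finset.univ
  have h1 : Fintype.card (Quotient (components
      (Finset.univ : Finset {p : Fin n × Fin n // p.1 < p.2}))) = 1 := by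
    rw [components_univ, Fintype.card_eq_one_iff]
    refine ⟨Quotient.mk _ 0, fun c => ?_⟩
    induction c using Quotient.inductionOn with
    | h x => exact Quotient.sound trivial
  omega

theorem rank_rootsA_le_card {n : ℕ} (B : Finset {p : Fin n × Fin n // p.1 < p.2}) :
    rank (rootsA n) B ≤ B.card := by
  rw [rank, ← Finset.coe_image]
  exact (finrank_span_finset_le_card _).trans Finset.card_image_le

theorem charPolyWeightA_eq_sum_graph {n : ℕ} [NeZero n] :
    charPolyWeightA n = ∑ B : Finset {p : Fin n × Fin n // p.1 < p.2},
      (-1) ^ B.card * ((blockGcd (components B) : ℤ[X]) *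
        Polynomial.X ^ (Fintype.card (Quotient (components B)) - 1)) := by
  have h0 : Module.finrank ℤ (weightLattice n) - (n - 1) = 0 :=
    Nat.sub_eq_zero_of_le finrank_weightLattice_le
  rw [charPolyWeightA, charPoly, tutte, rank_rootsA_univ, h0, map_sum, Finset.mul_sum]
  refine Finset.sum_congr rfl fun B _ => ?_
  have hr := rank_rootsA B
  have hc := rank_rootsA_le_card B
  have hpos : 0 < Fintype.card (Quotient (components B)) :=
    Fintype.card_pos_iff.mpr ⟨Quotient.mk _ 0⟩
  have he : n - 1 - rank (rootsA n) B = Fintype.card (Quotient (components B)) - 1 := by omega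
  rw [latticeMult_rootsA, he]
  simp only [map_mul, map_pow, map_sub, map_one, map_natCast, MvPolynomial.aeval_X,
    Matrix.cons_val_zero, Matrix.cons_val_one, pow_zero, mul_one, zero_sub]
  set m := Fintype.card (Quotient (components B)) - 1 with hm
  have h1 : (1 - Polynomial.X - 1 : ℤ[X]) ^ m = (-1) ^ m * Polynomial.X ^ m := by
    rw [← mul_pow]
    ring
  have h2 : ((-1) ^ (n - 1) * (-1) ^ m * (-1) ^ (B.card - rank (rootsA n) B) : ℤ[X]) =
      (-1) ^ B.card := by
    rw [← pow_add, ← pow_add]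
    -- Here `n - 1 - r(B) = m`, so all signs except `(-1)^|B|` cancel; `hc` rules out truncation.
    have : n - 1 + m + (B.card - rank (rootsA n) B) = B.card + 2 * m := by omega
    rw [this, pow_add, pow_mul]
    simp
  rw [h1, ← h2]
  ring

end Assembly

end ArithTutte

end

theorem theorem5p3 (n : ℕ) (hn : 1 ≤ n) :
    ArithTutte.charPolyWeightA n =
      ∑ k ∈ Finset.Icc 1 n,
        (-1) ^ (n - k) * (ArithTutte.gcdSum n k : ℤ[X]) * Polynomial.X ^ (k - 1) := by
  classical
  have : NeZero n := ⟨by omega⟩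
  rw [ArithTutte.charPolyWeightA_eq_sum_graph, ArithTutte.sum_graph_eq_sum_perm
    (fun s => (ArithTutte.blockGcd s : ℤ[X]) * Polynomial.X ^ (Fintype.card (Quotient s) - 1)),
    ← Finset.sum_fiberwise_of_maps_to
      (fun π _ => ArithTutte.card_cycleLengths_mem_Icc (n := n) π)]
  refine Finset.sum_congr rfl fun k _ => ?_
  rw [ArithTutte.gcdSum, ArithTutte.permsWithCycles, Nat.cast_sum, Finset.mul_sum, Finset.sum_mul]
  refine Finset.sum_congr (by congr) fun π hπ => ?_
  have hk := (Finset.mem_filter.mp hπ).2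
  rw [ArithTutte.sign_eq_neg_one_pow_sub_card_cycleLengths, ← ArithTutte.card_cycleLengths,
    ← ArithTutte.gcd_cycleLengths, hk]
  push_cast
  ring
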